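/- Let $d\ge 0$ and let $\mathcal O\subset\mathbb R^d$ be a bounded open set with closure $\bar{\mathcal O}$ and boundary $\partial\mathcal O$. For $x\in\partial\mathcal O$ let $\mathbf n(x)$ be the set of unit outward normal vectors at $x$, i.e. of all $k\in\mathbb R^d$ with $|k|=1$ for which there is $C\ge 0$ such that $(x-x',k)+C|x-x'|^2\ge 0$ for all $x'\in\bar{\mathcal O}$. Assume: (i) there is $C_0\ge 0$ such that $(x-x',k)+C_0|x-x'|^2\ge 0$ for all $x\in\partial\mathcal O$, $x'\in\bar{\mathcal O}$, $k\in\mathbf n(x)$; (ii) if $x\in\partial\mathcal O$, $k\in\mathbb R^d$, $C\ge0$ and $(x-x',k)+C|x-x'|^2\ge 0$ for all $x'\in\bar{\mathcal O}$, then $k=\theta m$ for some $\theta\ge 0$ and $m\in\mathbf n(x)$ (in particular $\mathbf n(x)\neq\varnothing$); (iii) there are $N\ge 1$, $\alpha>0$, $R>0$, unit vectors $a_1,\dots,a_N\in\mathbb R^d$ and points $x_1,\dots,x_N\in\partial\mathcal O$ such that $\partial\mathcal O\subset\bigcup_{i=1}^N B(x_i,R)$ and $(\xi,a_i)\ge\alpha$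 for all $i$, all $x\in\partial\mathcal O\cap B(x_i,2R)$ and all $\xi\in\mathbf n(x)$. Let $b:\mathbb R^d\to\mathbb R^d$ and $\sigma:\mathbb R^d\to\mathbb R^{d\times d}$ be bounded and Lipschitz. Given $w:[0,1]\to\mathbb R^d$, say that a pair $(z,k)$ of continuous functions on $[0,1]$ solves the reflection problem with input $w$ if $z_t=w_t-k_t\in\bar{\mathcal O}$ for all $t\in[0,1]$, $k$ has bounded variation with $k_0=0$, and, with $|k|_t$ the total variation of $k$ on $[0,t]$, $$k_t=\int_0^t\xi_s\,d|k|_s,\qquad |k|_t=\int_0^t \mathbf 1_{\{z_s\in\partial\mathcal O\}}\,d|k|_s ,\qquad t\in[0,1],$$ for some $d|k|$-measurable $\xi$ with $\xi_s\in\mathbf n(z_s)$ for $d|k|$-almost every $s$. For $\psi\in L^2([0,1];\mathbb R^d)$ and $x\in\bar{\mathcal O}$: * $(z^\psi(x),k^\psi(x))$ is a solution of the skeleton equation if it solves the reflection problem with input $w_t=x+\int_0^t b(z^\psi_s(x))\,ds+\int_0^t\sigma(z^\psi_s(x))\psi(s)\,ds$; * $(z^\psi_n(\cdot,x),k^\psi_n(\cdot,x))$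 is an $n$-th Euler approximation if it solves the reflection problem with input $w_t=x+\int_0^t b(z^\psi_n(\phi_n(s),x))\,ds+\int_0^t\sigma(z^\psi_n(\phi_n(s),x))\psi(s)\,ds$, where $\phi_n(t)=j2^{-n}$ for $t\in[j2^{-n},(j+1)2^{-n})$, $j=0,\dots,2^n-1$, and $\phi_n(1)=1-2^{-n}$. Put $I_1(\psi)=\frac12\int_0^1|\psi(s)|^2\,ds$ for $\psi\in L^2([0,1];\mathbb R^d)$ and $I_1(\psi)=+\infty$ otherwise. Then for every $r>0$ $$\lim_{n\to\infty}\ \sup_{\psi:\,I_1(\psi)\le r}\ \sup_{x\in\bar{\mathcal O}}\ \sup_{t\in[0,1]}\ \bigl|z_n^\psi(t,x)-z^\psi_t(x)\bigr|=0 ,$$ where the supremum also runs over all solutions $z^\psi(x)$ of the skeleton equation and all $n$-th Euler approximations $z^\psi_n(\cdot,x)$. -/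

import Mathlib

open Set Filter Topology MeasureTheory
open scoped NNReal ENNReal

noncomputable section

namespace Reflected

/-- The Euclidean space `ℝ^d`. -/
abbrev E (d : ℕ) : Type := EuclideanSpace ℝ (Fin d)

/-! ### The domain and its normals -/

/-- The cone of unit outward normal vectors to `∂O` at `x`: the unit vectors `k` for which there is
a constant `C ≥ 0` with `(x - x', k) + C |x - x'|² ≥ 0` for all `x' ∈ Ō`. -/
def unitNormals {d : ℕ} (O : Set (E d)) (x : E d) : Set (E d) :=
  {k | ‖k‖ = 1 ∧ ∃ C : ℝ, 0 ≤ C ∧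
    ∀ x' ∈ closure O, 0 ≤ inner ℝ (x - x') k + C * ‖x - x'‖ ^ 2}

/-- The geometric conditions on the domain `O`. -/
structure DomainConditions {d : ℕ} (O : Set (E d)) : Prop where
  /-- The constant in the exterior ball condition is uniform. -/
  uniform : ∃ C₀ : ℝ, 0 ≤ C₀ ∧ ∀ x ∈ frontier O, ∀ x' ∈ closure O, ∀ k ∈ unitNormals O x,
    0 ≤ inner ℝ (x - x') k + C₀ * ‖x - x'‖ ^ 2
  /-- Every vector satisfying the exterior ball inequality is a nonnegative multiple of a normal.
  (For `k = 0` this says that there is at least one normal at `x`.) -/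
  multiple : ∀ x ∈ frontier O, ∀ k : E d,
    (∃ C : ℝ, 0 ≤ C ∧ ∀ x' ∈ closure O, 0 ≤ inner ℝ (x - x') k + C * ‖x - x'‖ ^ 2) →
      ∃ θ : ℝ, 0 ≤ θ ∧ ∃ m ∈ unitNormals O x, k = θ • m
  /-- Finitely many directions that are uniformly transversal to the boundary. -/
  transversal : ∃ N : ℕ, 1 ≤ N ∧ ∃ α : ℝ, 0 < α ∧ ∃ R : ℝ, 0 < R ∧
    ∃ a : Fin N → E d, (∀ i, ‖a i‖ = 1) ∧
    ∃ p : Fin N → E d, (∀ i, p i ∈ frontier O) ∧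
      frontier O ⊆ ⋃ i, Metric.ball (p i) R ∧
      ∀ i, ∀ x ∈ frontier O ∩ Metric.ball (p i) (2 * R), ∀ ξ ∈ unitNormals O x,
        α ≤ inner ℝ ξ (a i)

/-- The first two conditions leave no choice for the normals: any set of unit vectors that
satisfies them at the boundary point `x` is `unitNormals O x`. In particular `unitNormals O x`
consists of the classical unit outward normal whenever the latter satisfies the two conditions. -/
theorem eq_unitNormals {d : ℕ} (O : Set (E d)) (x : E d) (n : Set (E d))
    (hunit : ∀ k ∈ n, ‖k‖ = 1)
    (h₁ : ∃ C₀ : ℝ, 0 ≤ C₀ ∧ ∀ x' ∈ closure O, ∀ k ∈ n,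
      0 ≤ inner ℝ (x - x') k + C₀ * ‖x - x'‖ ^ 2)
    (h₂ : ∀ k : E d,
      (∃ C : ℝ, 0 ≤ C ∧ ∀ x' ∈ closure O, 0 ≤ inner ℝ (x - x') k + C * ‖x - x'‖ ^ 2) →
        ∃ θ : ℝ, 0 ≤ θ ∧ ∃ m ∈ n, k = θ • m) :
    n = unitNormals O x := by
  ext k
  constructor
  · intro hk
    obtain ⟨C₀, hC₀, h⟩ := h₁
    exact ⟨hunit k hk, C₀, hC₀, fun x' hx' => h x' hx' k hk⟩
  · rintro ⟨hk, hC⟩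
    obtain ⟨θ, hθ, m, hm, rfl⟩ := h₂ k hC
    rw [norm_smul, hunit m hm, mul_one, Real.norm_of_nonneg hθ] at hk
    simpa [hk] using hm

/-! ### The total variation measure -/

theorem boundedVariationOn_extend {d : ℕ} {k : ℝ → E d} (hk : BoundedVariationOn k (Icc 0 1)) :
    BoundedVariationOn (fun t : ℝ => k (projIcc 0 1 zero_le_one t)) univ := by
  have h := eVariationOn.comp_le_of_monotoneOn k (s := Icc (0 : ℝ) 1) (t := univ)
    (fun t : ℝ => (projIcc (0 : ℝ) 1 zero_le_one t : ℝ))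
    (fun s _ t _ hst => monotone_projIcc zero_le_one hst)
    (fun t _ => (projIcc (0 : ℝ) 1 zero_le_one t).2)
  exact ne_top_of_le_ne_top hk h

/-- The measure `d|k|` on `[0,1]`: the Lebesgue-Stieltjes measure of the total variation
`t ↦ |k|_t` of a function `k` of bounded variation on `[0,1]` (extended by constants outside). -/
def dVar {d : ℕ} {k : ℝ → E d} (hk : BoundedVariationOn k (Icc 0 1)) : Measure ℝ :=
  ((boundedVariationOn_extend hk).stieltjesFunctionRightLim 0).measure

/-! ### Reflected equations -/

/-- The pair `(z, k)` of continuous functions on `[0,1]` solves the reflection problem in `Ō` with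
input `w`:
`z_t = w_t - k_t ∈ Ō`, `k` has bounded variation, `k_0 = 0`,
`k_t = ∫_0^t ξ_s d|k|_s` with `ξ_s` a unit outward normal at `z_s`, and
`|k|_t = ∫_0^t 1_{z_s ∈ ∂O} d|k|_s`. -/
structure IsReflected {d : ℕ} (O : Set (E d)) (w z k : ℝ → E d) : Prop where
  continuousOn_path : ContinuousOn z (Icc 0 1)
  continuousOn_push : ContinuousOn k (Icc 0 1)
  mem_closure : ∀ t ∈ Icc (0 : ℝ) 1, z t ∈ closure O
  push_zero : k 0 = 0
  boundedVariation : BoundedVariationOn k (Icc 0 1)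
  equation : ∀ t ∈ Icc (0 : ℝ) 1, z t = w t - k t
  direction : ∃ ξ : ℝ → E d,
    AEStronglyMeasurable ξ ((dVar boundedVariation).restrict (Icc 0 1)) ∧
    (∀ᵐ s ∂(dVar boundedVariation).restrict (Icc 0 1), ξ s ∈ unitNormals O (z s)) ∧
    ∀ t ∈ Icc (0 : ℝ) 1, k t = ∫ s in Icc 0 t, ξ s ∂(dVar boundedVariation)
  carried : ∀ t ∈ Icc (0 : ℝ) 1, eVariationOn k (Icc 0 t) =
    ∫⁻ s in Icc 0 t, indicator {u | z u ∈ frontier O} (fun _ => 1) s ∂(dVar boundedVariation)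

/-- `(z, k)` solves the skeleton equation with control `ψ` started at `x`. -/
def IsSkeletonSolution {d : ℕ} (O : Set (E d)) (b : E d → E d) (σ : E d → E d →L[ℝ] E d)
    (ψ : ℝ → E d) (x : E d) (z k : ℝ → E d) : Prop :=
  IsReflected O
    (fun t => x + (∫ s in (0 : ℝ)..t, b (z s)) + ∫ s in (0 : ℝ)..t, σ (z s) (ψ s)) z k

/-- The dyadic step function: `j / 2^n` on `[j / 2^n, (j + 1) / 2^n)` for `j = 0, …, 2^n - 1`,
the last interval being closed. -/
def dyadicStep (n : ℕ) (t : ℝ) : ℝ := (min ⌊2 ^ n * t⌋₊ (2 ^ n - 1) : ℕ) / 2 ^ n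

/-- `(z, k)` is the `n`-th Euler approximation of the skeleton equation with control `ψ` started
at `x`: the coefficients are frozen along the dyadic step function. -/
def IsEulerSolution {d : ℕ} (O : Set (E d)) (b : E d → E d) (σ : E d → E d →L[ℝ] E d)
    (n : ℕ) (ψ : ℝ → E d) (x : E d) (z k : ℝ → E d) : Prop :=
  IsReflected O
    (fun t => x + (∫ s in (0 : ℝ)..t, b (z (dyadicStep n s)))
      + ∫ s in (0 : ℝ)..t, σ (z (dyadicStep n s)) (ψ s)) z k

open scoped Classical in
/-- The action `I₁(ψ) = ½ ∫_0^1 |ψ(s)|² ds` if `ψ ∈ L²([0,1]; ℝ^d)`, and `+∞` otherwise. -/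
def action {d : ℕ} (ψ : ℝ → E d) : ℝ≥0∞ :=
  if MemLp ψ 2 (volume.restrict (Icc 0 1)) then
    ENNReal.ofReal (1 / 2 * ∫ s in (0 : ℝ)..1, ‖ψ s‖ ^ 2)
  else ⊤

end Reflected

end

/-! Both solutions have the form `dz = g dt - ξ dν`, with `ξ` a unit outward normal and `ν` a finite
positive measure carried by the times on the boundary. For two such paths with difference `D`, the
uniform exterior ball condition gives `-2(D, ξ) ≤ 2C|D|²`, so each push enters the growth of `|D|²`
only through the factor `exp(2Cν)`. Gronwall then bounds `|D|²` by the discrepancy of the drifts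
(`IsPushedPath.norm_sub_sq_le`), provided the total pushes are bounded.

That bound comes from transversality. While the path stays within `R/2` of its starting point, all
normals met have inner product at least `α` with one direction, so the push is controlled by
displacement plus drift (`IsPushedPath.mul_measureReal_le`). Comparing the path with a constant one
by the same stability estimate bounds the displacement by a multiple of the drift; a continuity
argument closes the loop (`IsPushedPath.oscillation_le`), and summing over short intervals bounds
the total push.

An energy bound on `ψ` makes the drift over `[s, t]` at most a constant times `√(t - s)`, uniformly
in `ψ`. Freezing the coefficients on the dyadic grid therefore costs `O(2^(-n/2))`, and stability
carries this rate to the solutions. -/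

namespace Reflected

/-! ### Real functions controlled by their increments -/

/-- A bound between the increments of two functions over all short subintervals of `[a, b]` holds
over `[a, b]`. -/
theorem sub_le_sub_of_forall_short {F G : ℝ → ℝ} {a b η : ℝ} (hab : a ≤ b) (hη : 0 < η)
    (h : ∀ s t, a ≤ s → s ≤ t → t ≤ b → t - s < η → F t - F s ≤ G t - G s) :
    F b - F a ≤ G b - G a := by
  -- Cut `[a, b]` into `N` equal pieces shorter than `η` and telescope.
  obtain ⟨N, hN⟩ := exists_nat_gt ((b - a) / η)
  have hba : 0 ≤ b - a := sub_nonneg.2 hab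
  have hN0 : (0 : ℝ) < N := (div_nonneg hba hη.le).trans_lt hN
  set x : ℕ → ℝ := fun i => a + i * ((b - a) / N) with hx
  have hstep : 0 ≤ (b - a) / N := by positivity
  have hlen : ∀ i : ℕ, x (i + 1) - x i = (b - a) / N := by
    intro i; simp only [hx]; push_cast; ring
  have h0 : x 0 = a := by simp [hx]
  have h1 : x N = b := by simp only [hx]; field_simp; ring
  have key : ∑ i ∈ Finset.range N, (F (x (i + 1)) - F (x i))
      ≤ ∑ i ∈ Finset.range N, (G (x (i + 1)) - G (x i)) := by
    refine Finset.sum_le_sum fun i hi => h _ _ ?_ ?_ ?_ ?_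
    · simp only [hx]; nlinarith [(Nat.cast_nonneg i : (0 : ℝ) ≤ i)]
    · linarith [hlen i]
    · have : ((i + 1 : ℕ) : ℝ) ≤ N := by exact_mod_cast Finset.mem_range.1 hi
      calc x (i + 1) ≤ x N := by
            simp only [hx]; gcongr
        _ = b := h1
    · rw [hlen, div_lt_iff₀ hN0]
      rw [div_lt_iff₀ hη] at hN
      linarith
  rwa [Finset.sum_range_sub (fun i => F (x i)), Finset.sum_range_sub (fun i => G (x i)), h0, h1]
    at key

/-- Gronwall's inequality for a function whose increments are controlled by those of the monotone
functions `A`, `B` and, up to an arbitrarily small factor, `T`. -/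
theorem le_exp_mul_of_increment_le {u A B T : ℝ → ℝ} {a b : ℝ} (hab : a ≤ b)
    (hA : MonotoneOn A (Icc a b)) (hB : MonotoneOn B (Icc a b)) (hT : MonotoneOn T (Icc a b))
    (h : ∀ ε > 0, ∃ η > 0, ∀ s t, a ≤ s → s ≤ t → t ≤ b → t - s < η →
      u t - u s ≤ u s * (A t - A s) + (B t - B s) + ε * (T t - T s))
    (hu : ∀ t ∈ Icc a b, 0 ≤ u t) :
    u b ≤ Real.exp (A b - A a) * (u a + (B b - B a)) := by
  have hT0 : 0 ≤ T b - T a := sub_nonneg.2 (hT ⟨le_rfl, hab⟩ ⟨hab, le_rfl⟩ hab)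
  have main : ∀ ε > 0, Real.exp (-(A b - A a)) * u b ≤ u a + (B b - B a) + ε * (T b - T a) := by
    intro ε hε
    obtain ⟨η, hη, hs⟩ := h ε hε
    -- Integrating factor: on short intervals `1 + ΔA ≤ exp(ΔA)` absorbs the linear term, and the
    -- weight is at most 1 on the remaining ones.
    have := sub_le_sub_of_forall_short (F := fun t => Real.exp (-(A t - A a)) * u t)
      (G := fun t => B t + ε * T t) hab hη ?_
    · simp only [sub_self, neg_zero, Real.exp_zero, one_mul] at this
      linarith
    intro s t has hst htb hlt
    have hsm : s ∈ Icc a b := ⟨has, hst.trans htb⟩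
    have htm : t ∈ Icc a b := ⟨has.trans hst, htb⟩
    have h1 := hs s t has hst htb hlt
    have h2 : 0 ≤ B t - B s := sub_nonneg.2 (hB hsm htm hst)
    have h3 : 0 ≤ T t - T s := sub_nonneg.2 (hT hsm htm hst)
    have h4 : 0 ≤ A t - A a := sub_nonneg.2 (hA ⟨le_rfl, hab⟩ htm (has.trans hst))
    have h5 : Real.exp (-(A s - A a)) =
        Real.exp (-(A t - A a)) * Real.exp (A t - A s) := by
      rw [← Real.exp_add]; ring_nf
    have h6 := Real.add_one_le_exp (A t - A s)
    have h7 : Real.exp (-(A t - A a)) ≤ 1 := Real.exp_le_one_iff.2 (by linarith)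
    have h8 := Real.exp_pos (-(A t - A a))
    have h9 : u t - Real.exp (A t - A s) * u s ≤ (B t - B s) + ε * (T t - T s) := by
      nlinarith [hu s hsm]
    have h10 : 0 ≤ (B t - B s) + ε * (T t - T s) := by positivity
    show Real.exp (-(A t - A a)) * u t - Real.exp (-(A s - A a)) * u s
      ≤ B t + ε * T t - (B s + ε * T s)
    rw [h5]
    nlinarith
  have lim : Real.exp (-(A b - A a)) * u b ≤ u a + (B b - B a) := by
    refine le_of_forall_pos_le_add fun ε hε => ?_
    have hpos : 0 < T b - T a + 1 := by linarith
    refine (main (ε / (T b - T a + 1)) (by positivity)).trans ?_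
    have : ε / (T b - T a + 1) * (T b - T a) ≤ ε := by
      rw [div_mul_eq_mul_div, div_le_iff₀ hpos]; nlinarith
    linarith
  have := mul_le_mul_of_nonneg_left lim (Real.exp_pos (A b - A a)).le
  rwa [← mul_assoc, ← Real.exp_add, add_neg_cancel, Real.exp_zero, one_mul] at this

/-! ### Integrals over half-open intervals -/

theorem setIntegral_Ioc_sub {F : Type*} [NormedAddCommGroup F] [NormedSpace ℝ F] {μ : Measure ℝ}
    {f : ℝ → F} {a s t : ℝ} (hf : IntegrableOn f (Ioc a t) μ) (has : a ≤ s) (hst : s ≤ t) :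
    ∫ v in Ioc a t, f v ∂μ - ∫ v in Ioc a s, f v ∂μ = ∫ v in Ioc s t, f v ∂μ := by
  rw [← Ioc_union_Ioc_eq_Ioc has hst,
    setIntegral_union (Ioc_disjoint_Ioc_of_le le_rfl) measurableSet_Ioc
      (hf.mono_set (Ioc_subset_Ioc_right hst)) (hf.mono_set (Ioc_subset_Ioc_left has)),
    add_sub_cancel_left]

theorem measureReal_Ioc_sub {ν : Measure ℝ} [IsFiniteMeasure ν] {a s t : ℝ} (has : a ≤ s)
    (hst : s ≤ t) : ν.real (Ioc a t) - ν.real (Ioc a s) = ν.real (Ioc s t) := by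
  have := setIntegral_Ioc_sub (μ := ν) (f := fun _ => (1 : ℝ)) (a := a) (s := s) (t := t)
    (integrable_const _).integrableOn has hst
  simpa using this

theorem inner_setIntegral_le {F : Type*} [NormedAddCommGroup F] [InnerProductSpace ℝ F]
    [CompleteSpace F] {μ : Measure ℝ} {S : Set ℝ} {f : ℝ → F} {q : ℝ → ℝ} (y : F)
    (hf : IntegrableOn f S μ) (hq : IntegrableOn q S μ)
    (h : ∀ᵐ v ∂μ.restrict S, inner ℝ y (f v) ≤ q v) :
    inner ℝ y (∫ v in S, f v ∂μ) ≤ ∫ v in S, q v ∂μ := by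
  rw [← integral_inner hf y]
  exact integral_mono_ae (hf.const_inner y) hq h

/-! ### Normals and paths pushed along them -/

variable {d : ℕ} {O : Set (E d)}

/-- An interior point has no normals. -/
theorem unitNormals_eq_empty_of_mem {x : E d} (hO : IsOpen O) (hx : x ∈ O) :
    unitNormals O x = ∅ := by
  rw [eq_empty_iff_forall_notMem]
  rintro k ⟨hk, C, hC, h⟩
  obtain ⟨ε, hε, hball⟩ := Metric.isOpen_iff.1 hO x hx
  -- At the test point `x + τk` the exterior ball inequality reads `-τ + Cτ² ≥ 0`, which fails once
  -- `Cτ < 1`.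
  set τ : ℝ := min (ε / 2) (1 / (2 * (C + 1))) with hτ
  have hτ0 : 0 < τ := by positivity
  have hτε : τ < ε := (min_le_left _ _).trans_lt (by linarith)
  have hτC : C * τ < 1 := by
    have h1 : τ ≤ 1 / (2 * (C + 1)) := min_le_right _ _
    rw [le_div_iff₀ (by positivity)] at h1
    nlinarith
  have hmem : x + τ • k ∈ O := hball (by
    simp [norm_smul, hk, abs_of_pos hτ0, hτε])
  have := h _ (subset_closure hmem)
  rw [sub_add_cancel_left, inner_neg_left, real_inner_smul_left, real_inner_self_eq_norm_sq,
    norm_neg, norm_smul, hk, Real.norm_of_nonneg hτ0.le] at this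
  nlinarith

/-- A push in a normal direction can thus take place only at boundary points, where the geometric
conditions apply. -/
theorem mem_frontier_of_mem_unitNormals {x k : E d} (hO : IsOpen O) (hx : x ∈ closure O)
    (hk : k ∈ unitNormals O x) : x ∈ frontier O := by
  refine ⟨hx, fun hi => ?_⟩
  rw [hO.interior_eq] at hi
  simp [unitNormals_eq_empty_of_mem hO hi] at hk

/-- The path `z` stays in `Ō` and has the increments `dz = g dt - ξ dν`, where `ξ` is a unit
outward normal on the support of `ν`. -/
structure IsPushedPath (O : Set (E d)) (z g ξ : ℝ → E d) (ν : Measure ℝ) : Prop where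
  continuousOn : ContinuousOn z (Icc 0 1)
  mem_closure : ∀ t ∈ Icc (0 : ℝ) 1, z t ∈ closure O
  integrableOn : IntegrableOn g (Icc 0 1)
  aestronglyMeasurable : AEStronglyMeasurable ξ ν
  normal : ∀ᵐ s ∂ν, s ∈ Icc (0 : ℝ) 1 ∧ z s ∈ frontier O ∧ ξ s ∈ unitNormals O (z s)
  increment : ∀ s t, 0 ≤ s → s ≤ t → t ≤ 1 →
    z t - z s = (∫ v in Ioc s t, g v) - ∫ v in Ioc s t, ξ v ∂ν

/-- The comparison path that turns the stability estimate into an oscillation bound. -/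
theorem isPushedPath_const {c : E d} (hc : c ∈ closure O) :
    IsPushedPath O (fun _ => c) (fun _ => 0) (fun _ => 0) 0 where
  continuousOn := continuousOn_const
  mem_closure _ _ := hc
  integrableOn := integrableOn_zero
  aestronglyMeasurable := aestronglyMeasurable_zero_measure _
  normal := by simp
  increment := by simp

theorem IsPushedPath.integrable {z g ξ : ℝ → E d} {ν : Measure ℝ} [IsFiniteMeasure ν]
    (h : IsPushedPath O z g ξ ν) : Integrable ξ ν :=
  Integrable.of_bound h.aestronglyMeasurable 1 (h.normal.mono fun _ hs => hs.2.2.1.le)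

/-- The contribution of a push to the increment of the squared distance of two paths. -/
theorem IsPushedPath.neg_inner_le {z g ξ : ℝ → E d} {ν : Measure ℝ} [IsFiniteMeasure ν] {C : ℝ}
    (hO : ∀ x ∈ frontier O, ∀ x' ∈ closure O, ∀ k ∈ unitNormals O x,
      0 ≤ inner ℝ (x - x') k + C * ‖x - x'‖ ^ 2)
    (h : IsPushedPath O z g ξ ν) {z' : ℝ → E d} (hz' : ∀ t ∈ Icc (0 : ℝ) 1, z' t ∈ closure O)
    {s t e q : ℝ} {y : E d}
    (hy : ∀ v ∈ Ioc s t, ‖y - (2 : ℝ) • (z v - z' v)‖ ≤ e)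
    (hq : ∀ v ∈ Ioc s t, 2 * (C * ‖z v - z' v‖ ^ 2) ≤ q) :
    -inner ℝ y (∫ v in Ioc s t, ξ v ∂ν) ≤ (q + e) * ν.real (Ioc s t) := by
  -- The vector `y` is frozen so that it can leave the integral; replacing it by `2(z - z')` costs
  -- `e` per unit of mass because `|ξ| = 1`.
  have key := inner_setIntegral_le (μ := ν) (S := Ioc s t) (f := ξ) (q := fun _ => q + e) (-y)
    h.integrable.integrableOn (integrable_const _).integrableOn ?_
  · rw [inner_neg_left] at key
    refine key.trans_eq ?_
    simp [mul_comm]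
  filter_upwards [ae_restrict_of_ae h.normal, ae_restrict_mem measurableSet_Ioc]
    with v ⟨hv1, hvf, hvn⟩ hv
  have h1 := hO _ hvf _ (hz' v hv1) _ hvn
  have h2 := hy v hv
  have h3 := hq v hv
  have h4 := abs_real_inner_le_norm (y - (2 : ℝ) • (z v - z' v)) (ξ v)
  rw [hvn.1, mul_one] at h4
  have h5 := (abs_le.1 h4).1
  rw [inner_sub_left, real_inner_smul_left] at h5
  rw [inner_neg_left]
  linarith

/-! ### Stability of pushed paths -/

/-- Stability of pushed paths with respect to the drift. -/
theorem IsPushedPath.norm_sub_sq_le {z g ξ z' g' ξ' : ℝ → E d} {ν ν' : Measure ℝ}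
    [IsFiniteMeasure ν] [IsFiniteMeasure ν'] {C : ℝ} (hC : 0 ≤ C)
    (hO : ∀ x ∈ frontier O, ∀ x' ∈ closure O, ∀ k ∈ unitNormals O x,
      0 ≤ inner ℝ (x - x') k + C * ‖x - x'‖ ^ 2)
    (h : IsPushedPath O z g ξ ν) (h' : IsPushedPath O z' g' ξ' ν') {p : ℝ → ℝ} {δ a b : ℝ}
    (ha : 0 ≤ a) (hab : a ≤ b) (hb : b ≤ 1) (hδ : 0 ≤ δ) (hp : IntegrableOn p (Icc 0 1))
    (hp0 : ∀ v, 0 ≤ p v)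
    (hg : ∀ v ∈ Icc a b, ‖g v - g' v‖ ≤ p v * (‖z v - z' v‖ + δ)) :
    ‖z b - z' b‖ ^ 2 ≤
      Real.exp (3 * (∫ v in Ioc a b, p v) + 2 * C * (ν.real (Ioc a b) + ν'.real (Ioc a b))) *
        (‖z a - z' a‖ ^ 2 + δ ^ 2 * ∫ v in Ioc a b, p v) := by
  set D : ℝ → E d := fun v => z v - z' v with hD
  have hDc : ContinuousOn D (Icc 0 1) := h.continuousOn.sub h'.continuousOn
  obtain ⟨K, hK⟩ := isCompact_Icc.exists_bound_of_continuousOn hDc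
  have hK0 : 0 ≤ K := (norm_nonneg _).trans (hK 0 (by simp))
  have hpI : ∀ s t, a ≤ s → t ≤ b → IntegrableOn p (Ioc s t) := fun s t hs ht =>
    hp.mono_set fun v hv => ⟨ha.trans (hs.trans hv.1.le), hv.2.trans (ht.trans hb)⟩
  set P : ℝ → ℝ := fun t => ∫ v in Ioc a t, p v with hP
  set V : ℝ → ℝ := fun t => ν.real (Ioc a t) with hV
  set V' : ℝ → ℝ := fun t => ν'.real (Ioc a t) with hV'
  have hPs : ∀ s t, a ≤ s → s ≤ t → t ≤ b → P t - P s = ∫ v in Ioc s t, p v :=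
    fun s t hs hst ht => setIntegral_Ioc_sub (hpI a t le_rfl ht) hs hst
  have hVs : ∀ s t, a ≤ s → s ≤ t → V t - V s = ν.real (Ioc s t) :=
    fun s t hs hst => measureReal_Ioc_sub hs hst
  have hVs' : ∀ s t, a ≤ s → s ≤ t → V' t - V' s = ν'.real (Ioc s t) :=
    fun s t hs hst => measureReal_Ioc_sub hs hst
  have hPm : MonotoneOn P (Icc a b) := fun s hs t ht hst => by
    rw [← sub_nonneg, hPs s t hs.1 hst ht.2]
    exact setIntegral_nonneg measurableSet_Ioc fun v _ => hp0 v
  have hVm : MonotoneOn V (Icc a b) := fun s hs t ht hst => by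
    rw [← sub_nonneg, hVs s t hs.1 hst]; exact measureReal_nonneg
  have hVm' : MonotoneOn V' (Icc a b) := fun s hs t ht hst => by
    rw [← sub_nonneg, hVs' s t hs.1 hst]; exact measureReal_nonneg
  have key := le_exp_mul_of_increment_le (u := fun t => ‖D t‖ ^ 2)
    (A := fun t => 3 * P t + 2 * C * (V t + V' t)) (B := fun t => δ ^ 2 * P t)
    (T := fun t => P t + V t + V' t) hab ?_ ?_ ?_ ?_ (fun t _ => by positivity)
  · simpa [hP, hV, hV', hD, mul_add] using key
  · intro s hs t ht hst
    have := hPm hs ht hst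
    have := hVm hs ht hst
    have := hVm' hs ht hst
    show _ * _ + _ * _ ≤ _ * _ + _ * _
    gcongr
  · intro s hs t ht hst
    exact mul_le_mul_of_nonneg_left (hPm hs ht hst) (sq_nonneg δ)
  · intro s hs t ht hst
    exact add_le_add (add_le_add (hPm hs ht hst) (hVm hs ht hst)) (hVm' hs ht hst)
  intro ε hε
  -- Sum of the coefficients of `e` in the drift and push errors below, so that `e * c ≤ ε` handles
  -- both.
  set c : ℝ := (3 * K + 1 + δ) + (3 + 2 * C * (2 * K + 1)) with hc
  have hc0 : 0 < c := by positivity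
  set e : ℝ := min 1 (ε / c) with he
  have he0 : 0 < e := by positivity
  have he1 : e ≤ 1 := min_le_left _ _
  have hec : e * c ≤ ε := by
    have := min_le_right 1 (ε / c)
    rwa [← he, le_div_iff₀ hc0] at this
  obtain ⟨η, hη, hunif⟩ := Metric.uniformContinuousOn_iff.1
    (isCompact_Icc.uniformContinuousOn_of_continuous hDc) e he0
  refine ⟨η, hη, fun s t has hst htb hlt => ?_⟩
  have hs0 : 0 ≤ s := ha.trans has
  have ht1 : t ≤ 1 := htb.trans hb
  have hsm : s ∈ Icc (0 : ℝ) 1 := ⟨hs0, hst.trans ht1⟩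
  have hclose : ∀ v ∈ Icc s t, ‖D v - D s‖ ≤ e := fun v hv => by
    rw [← dist_eq_norm]
    refine (hunif v ⟨hs0.trans hv.1, hv.2.trans ht1⟩ s hsm ?_).le
    rw [Real.dist_eq, abs_of_nonneg (by linarith [hv.1])]
    linarith [hv.2]
  have hclose' : ∀ v ∈ Icc s t, ‖D v‖ ≤ ‖D s‖ + e := fun v hv => by
    have := norm_le_insert' (D v) (D s)
    linarith [hclose v hv]
  set x : ℝ := ‖D s‖ with hx
  have hx0 : 0 ≤ x := norm_nonneg _
  have hxK : x ≤ K := hK s hsm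
  set y : E d := D t + D s with hy
  have hyn : ‖y‖ ≤ 2 * x + e := by
    have := norm_add_le (D t) (D s)
    linarith [hclose' t ⟨hst, le_rfl⟩]
  have hy2 : ∀ v ∈ Icc s t, ‖y - (2 : ℝ) • D v‖ ≤ 3 * e := fun v hv => by
    have h1 : y - (2 : ℝ) • D v = (D t - D s) - (D v - D s) - (D v - D s) := by
      rw [hy, two_smul]; abel
    rw [h1]
    have h2 := norm_sub_le (D t - D s - (D v - D s)) (D v - D s)
    have h3 := norm_sub_le (D t - D s) (D v - D s)
    linarith [hclose v hv, hclose t ⟨hst, le_rfl⟩]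
  have hsqv : ∀ v ∈ Icc s t, ‖D v‖ ^ 2 ≤ x ^ 2 + e * (2 * K + 1) := fun v hv => by
    have := hclose' v hv
    have := norm_nonneg (D v)
    nlinarith
  have hgI : IntegrableOn g (Ioc s t) := h.integrableOn.mono_set fun v hv =>
    ⟨hs0.trans hv.1.le, hv.2.trans ht1⟩
  have hgI' : IntegrableOn g' (Ioc s t) := h'.integrableOn.mono_set fun v hv =>
    ⟨hs0.trans hv.1.le, hv.2.trans ht1⟩
  have hinc : D t - D s = (∫ v in Ioc s t, (g v - g' v)) - (∫ v in Ioc s t, ξ v ∂ν)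
      + ∫ v in Ioc s t, ξ' v ∂ν' := by
    rw [integral_sub hgI hgI']
    have h1 := h.increment s t hs0 hst ht1
    have h2 := h'.increment s t hs0 hst ht1
    have : D t - D s = (z t - z s) - (z' t - z' s) := by simp only [hD]; abel
    rw [this, h1, h2]; abel
  -- This polarization identity replaces a chain rule for `|D|²`; uniform continuity makes `D t + D
  -- s` nearly `2 D v` on the interval.
  have hsq : ‖D t‖ ^ 2 - ‖D s‖ ^ 2 = inner ℝ y (D t - D s) := by
    have : ∀ p q : E d, ‖p‖ ^ 2 - ‖q‖ ^ 2 = inner ℝ (p + q) (p - q) := fun p q => by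
      rw [inner_add_left, inner_sub_right, inner_sub_right, real_inner_self_eq_norm_sq,
        real_inner_self_eq_norm_sq, real_inner_comm]
      ring
    exact this _ _
  have hdrift : inner ℝ y (∫ v in Ioc s t, (g v - g' v)) ≤
      (3 * x ^ 2 + δ ^ 2 + e * (3 * K + 1 + δ)) * ∫ v in Ioc s t, p v := by
    rw [← integral_const_mul]
    refine inner_setIntegral_le y (hgI.sub hgI') ((hpI s t has htb).const_mul _) ?_
    filter_upwards [ae_restrict_mem measurableSet_Ioc] with v hv
    have hvI : v ∈ Icc s t := ⟨hv.1.le, hv.2⟩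
    have h1 := hg v ⟨has.trans hvI.1, hvI.2.trans htb⟩
    have h2 := hclose' v hvI
    -- The cross term satisfies `2xδ ≤ x² + δ²`, which is the source of the factor 3 in the
    -- exponent.
    have h3 : (2 * x + e) * (x + e + δ) ≤ 3 * x ^ 2 + δ ^ 2 + e * (3 * K + 1 + δ) := by
      nlinarith [sq_nonneg (x - δ)]
    calc inner ℝ y (g v - g' v) ≤ ‖y‖ * ‖g v - g' v‖ := real_inner_le_norm _ _
      _ ≤ (2 * x + e) * (p v * (x + e + δ)) := by
          refine mul_le_mul hyn (h1.trans ?_) (norm_nonneg _) (by positivity)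
          exact mul_le_mul_of_nonneg_left (by linarith) (hp0 v)
      _ = (2 * x + e) * (x + e + δ) * p v := by ring
      _ ≤ _ := mul_le_mul_of_nonneg_right h3 (hp0 v)
  have hq : ∀ v ∈ Icc s t,
      2 * (C * ‖D v‖ ^ 2) ≤ 2 * C * (x ^ 2 + e * (2 * K + 1)) := fun v hv => by
    have := mul_le_mul_of_nonneg_left (hsqv v hv) hC
    linarith
  have hpush := h.neg_inner_le (s := s) (t := t) (y := y) hO h'.mem_closure
    (fun v hv => hy2 v ⟨hv.1.le, hv.2⟩) (fun v hv => hq v ⟨hv.1.le, hv.2⟩)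
  have hpush' := h'.neg_inner_le (s := s) (t := t) (y := -y) (e := 3 * e)
    (q := 2 * C * (x ^ 2 + e * (2 * K + 1))) hO h.mem_closure
    (fun v hv => by
      have h1 : -y - (2 : ℝ) • (z' v - z v) = -(y - (2 : ℝ) • D v) := by
        simp only [hD, smul_sub]; abel
      rw [h1, norm_neg]
      exact hy2 v ⟨hv.1.le, hv.2⟩)
    (fun v hv => by rw [norm_sub_rev]; exact hq v ⟨hv.1.le, hv.2⟩)
  rw [inner_neg_left, neg_neg] at hpush'
  have hP0 : 0 ≤ P t - P s := by
    rw [hPs s t has hst htb]; exact setIntegral_nonneg measurableSet_Ioc fun v _ => hp0 v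
  have hV0 : 0 ≤ V t - V s := by rw [hVs s t has hst]; exact measureReal_nonneg
  have hV0' : 0 ≤ V' t - V' s := by rw [hVs' s t has hst]; exact measureReal_nonneg
  rw [← hPs s t has hst htb] at hdrift
  rw [← hVs s t has hst] at hpush
  rw [← hVs' s t has hst] at hpush'
  have hfin : ‖D t‖ ^ 2 - ‖D s‖ ^ 2 ≤
      (3 * x ^ 2 + δ ^ 2 + e * (3 * K + 1 + δ)) * (P t - P s)
      + (2 * C * (x ^ 2 + e * (2 * K + 1)) + 3 * e) * (V t - V s)
      + (2 * C * (x ^ 2 + e * (2 * K + 1)) + 3 * e) * (V' t - V' s) := by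
    rw [hsq, hinc, inner_add_right, inner_sub_right]
    linarith
  have e1 : e * (3 * K + 1 + δ) ≤ ε := by
    refine le_trans (mul_le_mul_of_nonneg_left ?_ he0.le) hec
    rw [hc]; linarith [show 0 ≤ 2 * C * (2 * K + 1) by positivity]
  have e2 : e * (3 + 2 * C * (2 * K + 1)) ≤ ε := by
    refine le_trans (mul_le_mul_of_nonneg_left ?_ he0.le) hec
    rw [hc]; linarith
  have f1 := mul_le_mul_of_nonneg_right e1 hP0
  have f2 := mul_le_mul_of_nonneg_right e2 hV0
  have f3 := mul_le_mul_of_nonneg_right e2 hV0'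
  show ‖D t‖ ^ 2 - ‖D s‖ ^ 2 ≤ x ^ 2 * ((3 * P t + 2 * C * (V t + V' t)) -
    (3 * P s + 2 * C * (V s + V' s))) + (δ ^ 2 * P t - δ ^ 2 * P s)
    + ε * ((P t + V t + V' t) - (P s + V s + V' s))
  linarith

/-! ### Oscillation and total push -/

/-- Around each boundary point one direction is transversal to all normals, uniformly. -/
theorem DomainConditions.exists_transversal (h : DomainConditions O) :
    ∃ α > 0, ∃ R > 0, ∀ x ∈ frontier O, ∃ c : E d, ‖c‖ = 1 ∧
      ∀ x' ∈ frontier O, ‖x' - x‖ ≤ R → ∀ m ∈ unitNormals O x', α ≤ inner ℝ m c := by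
  obtain ⟨N, -, α, hα, R, hR, a, ha, p, -, hcover, htr⟩ := h.transversal
  refine ⟨α, hα, R, hR, fun x hx => ?_⟩
  obtain ⟨i, hi⟩ := mem_iUnion.1 (hcover hx)
  refine ⟨a i, ha i, fun x' hx' hxx' m hm => htr i x' ⟨hx', ?_⟩ m hm⟩
  rw [Metric.mem_ball] at hi ⊢
  have := dist_triangle x' x (p i)
  rw [dist_eq_norm x' x] at this
  linarith

/-- While the path moves little, the mass of the push is controlled by the increment of the path
and the drift. -/
theorem IsPushedPath.mul_measureReal_le {z g ξ : ℝ → E d} {ν : Measure ℝ} [IsFiniteMeasure ν]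
    {α R : ℝ}
    (htr : ∀ x ∈ frontier O, ∃ c : E d, ‖c‖ = 1 ∧
      ∀ x' ∈ frontier O, ‖x' - x‖ ≤ R → ∀ m ∈ unitNormals O x', α ≤ inner ℝ m c)
    (h : IsPushedPath O z g ξ ν) {γ : ℝ → ℝ} (hγ : IntegrableOn γ (Icc 0 1)) (hγ0 : ∀ v, 0 ≤ γ v)
    (hg : ∀ v ∈ Icc (0 : ℝ) 1, ‖g v‖ ≤ γ v) {s t : ℝ} (hs : 0 ≤ s) (hst : s ≤ t) (ht : t ≤ 1)
    (hz : ∀ v ∈ Icc s t, ‖z v - z s‖ ≤ R / 2) :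
    α * ν.real (Ioc s t) ≤ ‖z t - z s‖ + ∫ v in Ioc s t, γ v := by
  have hI : 0 ≤ ∫ v in Ioc s t, γ v := setIntegral_nonneg measurableSet_Ioc fun v _ => hγ0 v
  have hsub : Ioc s t ⊆ Icc 0 1 := fun v hv => ⟨hs.trans hv.1.le, hv.2.trans ht⟩
  by_cases hν : ν (Ioc s t) = 0
  · rw [measureReal_def, hν]
    simp only [ENNReal.toReal_zero, mul_zero]
    positivity
  have hne : (ae (ν.restrict (Ioc s t))).NeBot := by
    rw [ae_neBot]; rwa [Ne, Measure.restrict_eq_zero]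
  have hev : ∀ᵐ v ∂ν.restrict (Ioc s t),
      (v ∈ Icc (0 : ℝ) 1 ∧ z v ∈ frontier O ∧ ξ v ∈ unitNormals O (z v)) ∧ v ∈ Ioc s t :=
    (ae_restrict_of_ae h.normal).and (ae_restrict_mem measurableSet_Ioc)
  -- The starting point `z s` may be interior, so the direction is taken at a boundary point visited
  -- at some time `u` of the interval; later comparisons cost `R/2 + R/2 = R`.
  obtain ⟨u, ⟨-, huf, -⟩, hu⟩ := hev.exists
  obtain ⟨c, hc, hcn⟩ := htr _ huf
  have key := inner_setIntegral_le (μ := ν) (S := Ioc s t) (f := ξ) (q := fun _ => -α) (-c)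
    h.integrable.integrableOn (integrable_const _).integrableOn ?_
  · rw [setIntegral_const, smul_eq_mul, inner_neg_left] at key
    have hinc : (∫ v in Ioc s t, ξ v ∂ν) = (∫ v in Ioc s t, g v) - (z t - z s) := by
      rw [h.increment s t hs hst ht]; abel
    have h1 : inner ℝ c (∫ v in Ioc s t, ξ v ∂ν) ≤ ‖(∫ v in Ioc s t, ξ v ∂ν)‖ := by
      simpa [hc] using real_inner_le_norm c (∫ v in Ioc s t, ξ v ∂ν)
    have h2 : ‖(∫ v in Ioc s t, ξ v ∂ν)‖ ≤ ‖(∫ v in Ioc s t, g v)‖ + ‖z t - z s‖ := by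
      rw [hinc]; exact norm_sub_le _ _
    have h3 : ‖(∫ v in Ioc s t, g v)‖ ≤ ∫ v in Ioc s t, γ v :=
      norm_integral_le_of_norm_le (hγ.mono_set hsub)
        ((ae_restrict_mem measurableSet_Ioc).mono fun v hv => hg v (hsub hv))
    linarith
  filter_upwards [ae_restrict_of_ae h.normal, ae_restrict_mem measurableSet_Ioc]
    with v ⟨_, hvf, hvn⟩ hv
  rw [inner_neg_left, real_inner_comm]
  refine neg_le_neg (hcn _ hvf ?_ _ hvn)
  have h1 := hz v ⟨hv.1.le, hv.2⟩
  have h2 := hz u ⟨hu.1.le, hu.2⟩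
  have h3 := norm_sub_le (z v - z s) (z u - z s)
  rw [sub_sub_sub_cancel_right] at h3
  linarith

/-- The constant in the bound of the oscillation of a pushed path by its drift. -/
noncomputable def oscillationConst (C α R : ℝ) : ℝ :=
  Real.exp ((3 + 2 * C * ((R / 2 + 1) / α)) / 2)

/-- A pushed path with small drift has small oscillation and small push. -/
theorem IsPushedPath.oscillation_le {z g ξ : ℝ → E d} {ν : Measure ℝ} [IsFiniteMeasure ν]
    {C α R : ℝ} (hC : 0 ≤ C)
    (hO : ∀ x ∈ frontier O, ∀ x' ∈ closure O, ∀ k ∈ unitNormals O x,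
      0 ≤ inner ℝ (x - x') k + C * ‖x - x'‖ ^ 2)
    (hα : 0 < α) (hR : 0 < R)
    (htr : ∀ x ∈ frontier O, ∃ c : E d, ‖c‖ = 1 ∧
      ∀ x' ∈ frontier O, ‖x' - x‖ ≤ R → ∀ m ∈ unitNormals O x', α ≤ inner ℝ m c)
    (h : IsPushedPath O z g ξ ν) {γ : ℝ → ℝ} (hγ : IntegrableOn γ (Icc 0 1)) (hγ0 : ∀ v, 0 ≤ γ v)
    (hg : ∀ v ∈ Icc (0 : ℝ) 1, ‖g v‖ ≤ γ v) {s t ω : ℝ} (hs : 0 ≤ s) (hst : s ≤ t) (ht : t ≤ 1)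
    (hω : 0 < ω) (hγω : (∫ v in Ioc s t, γ v) ≤ ω) (hω1 : ω ≤ 1)
    (hωR : oscillationConst C α R * ω ≤ R / 4) :
    ‖z t - z s‖ ≤ oscillationConst C α R * ω ∧
      α * ν.real (Ioc s t) ≤ (oscillationConst C α R + 1) * ω := by
  set κ := oscillationConst C α R with hκ
  have hκ0 : 0 < κ := Real.exp_pos _
  have hsub : Icc s t ⊆ Icc (0 : ℝ) 1 := Icc_subset_Icc hs ht
  have hI : ∀ τ ∈ Icc s t, (∫ v in Ioc s τ, γ v) ≤ ω := fun τ hτ =>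
    (setIntegral_mono_set (hγ.mono_set (Ioc_subset_Icc_self.trans hsub))
      (Eventually.of_forall hγ0)
      (Ioc_subset_Ioc_right hτ.2).eventuallyLE).trans hγω
  have hstep : ∀ τ ∈ Icc s t, (∀ v ∈ Icc s τ, ‖z v - z s‖ ≤ R / 2) → ‖z τ - z s‖ ≤ κ * ω := by
    intro τ hτ hv
    have hV := h.mul_measureReal_le htr hγ hγ0 hg hs hτ.1 (hτ.2.trans ht) hv
    have hV' : ν.real (Ioc s τ) ≤ (R / 2 + 1) / α := by
      rw [le_div_iff₀ hα]
      linarith [hv τ ⟨hτ.1, le_rfl⟩, hI τ hτ]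
    have hP : (∫ v in Ioc s τ, γ v / ω) ≤ 1 := by
      rw [integral_div, div_le_one hω]; exact hI τ hτ
    have hP0 : 0 ≤ ∫ v in Ioc s τ, γ v / ω :=
      setIntegral_nonneg measurableSet_Ioc fun v _ => div_nonneg (hγ0 v) hω.le
    -- Compare with the constant path `z s`, taking `p = γ/ω` and `δ = ω`: then `∫ p ≤ 1` and the
    -- initial distance vanishes, so the squared displacement is at most `κ²ω²`.
    have key := h.norm_sub_sq_le hC hO
      (isPushedPath_const (h.mem_closure s (hsub ⟨le_rfl, hst⟩))) (p := fun v => γ v / ω)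
      (δ := ω) hs hτ.1 (hτ.2.trans ht) hω.le (hγ.div_const ω)
      (fun v => div_nonneg (hγ0 v) hω.le) (fun v hv => by
        have h1 := hg v ⟨hs.trans hv.1, hv.2.trans (hτ.2.trans ht)⟩
        have h2 : 0 ≤ γ v / ω * ‖z v - z s‖ :=
          mul_nonneg (div_nonneg (hγ0 v) hω.le) (norm_nonneg _)
        rw [mul_add, div_mul_cancel₀ _ hω.ne', sub_zero]
        linarith)
    simp only [sub_self, norm_zero, ne_eq, OfNat.ofNat_ne_zero, not_false_eq_true, zero_pow,
      zero_add, measureReal_zero, Pi.zero_apply, add_zero] at key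
    have hsq : ‖z τ - z s‖ ^ 2 ≤ (κ * ω) ^ 2 := by
      have h1 : κ ^ 2 = Real.exp (3 + 2 * C * ((R / 2 + 1) / α)) := by
        rw [hκ, oscillationConst, ← Real.exp_nat_mul]; congr 1; push_cast; ring
      rw [mul_pow, h1]
      refine key.trans (mul_le_mul (Real.exp_le_exp.2 ?_) ?_ (by positivity) (Real.exp_pos _).le)
      · have := mul_le_mul_of_nonneg_left hV' (show 0 ≤ 2 * C by positivity)
        linarith
      · nlinarith [sq_nonneg ω]
    exact (pow_le_pow_iff_left₀ (norm_nonneg _) (by positivity) two_ne_zero).1 hsq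
  have hfc : ContinuousOn (fun v => ‖z v - z s‖) (Icc s t) :=
    ((h.continuousOn.mono hsub).sub continuousOn_const).norm
  -- At the first time `τ` when the displacement reaches `R/2`, `hstep` would bound it by `κω ≤
  -- R/4`.
  have hsmall : ∀ v ∈ Icc s t, ‖z v - z s‖ ≤ R / 2 := by
    by_contra! hcon
    obtain ⟨v₀, hv₀, hlarge⟩ := hcon
    have hcomp : IsCompact (Icc s t ∩ (fun v => ‖z v - z s‖) ⁻¹' Ici (R / 2)) :=
      isCompact_Icc.of_isClosed_subset (hfc.preimage_isClosed_of_isClosed isClosed_Icc isClosed_Ici)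
        inter_subset_left
    obtain ⟨τ, ⟨hτ, hτR⟩, hleast⟩ := hcomp.exists_isLeast ⟨v₀, hv₀, hlarge.le⟩
    have hτR : R / 2 ≤ ‖z τ - z s‖ := hτR
    have hle : ∀ v ∈ Icc s τ, ‖z v - z s‖ ≤ R / 2 := by
      intro v hv
      by_contra! hlt
      have hivt := intermediate_value_Icc hv.1 (hfc.mono (Icc_subset_Icc_right (hv.2.trans hτ.2)))
      obtain ⟨w, hw, hwR⟩ := hivt ⟨by simp; positivity, hlt.le⟩
      have hwR : ‖z w - z s‖ = R / 2 := hwR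
      have : τ ≤ w := hleast ⟨⟨hw.1, hw.2.trans (hv.2.trans hτ.2)⟩, hwR.ge⟩
      have : w = v := le_antisymm hw.2 (hv.2.trans this)
      rw [this] at hwR
      linarith
    linarith [hstep τ hτ hle]
  have h1 := hstep t ⟨hst, le_rfl⟩ hsmall
  refine ⟨h1, ?_⟩
  have := h.mul_measureReal_le htr hγ hγ0 hg hs hst ht hsmall
  linarith

/-- The total mass of the push is controlled by the total drift. -/
theorem IsPushedPath.mul_measureReal_univ_le {z g ξ : ℝ → E d} {ν : Measure ℝ}
    [IsFiniteMeasure ν] {C α R : ℝ} (hC : 0 ≤ C)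
    (hO : ∀ x ∈ frontier O, ∀ x' ∈ closure O, ∀ k ∈ unitNormals O x,
      0 ≤ inner ℝ (x - x') k + C * ‖x - x'‖ ^ 2)
    (hα : 0 < α) (hR : 0 < R)
    (htr : ∀ x ∈ frontier O, ∃ c : E d, ‖c‖ = 1 ∧
      ∀ x' ∈ frontier O, ‖x' - x‖ ≤ R → ∀ m ∈ unitNormals O x', α ≤ inner ℝ m c)
    (h : IsPushedPath O z g ξ ν) {γ : ℝ → ℝ} (hγ : IntegrableOn γ (Icc 0 1)) (hγ0 : ∀ v, 0 ≤ γ v)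
    (hg : ∀ v ∈ Icc (0 : ℝ) 1, ‖g v‖ ≤ γ v) {η : ℝ} (hη : 0 < η)
    (hsmall : ∀ s t, 0 ≤ s → s < t → t ≤ 1 → t - s < η →
      0 < (∫ v in Ioc s t, γ v) ∧ (∫ v in Ioc s t, γ v) ≤ 1 ∧
        oscillationConst C α R * ∫ v in Ioc s t, γ v ≤ R / 4) :
    α * ν.real (Ioc 0 1) ≤ (oscillationConst C α R + 1) * ∫ v in Ioc 0 1, γ v := by
  -- On each short interval take `ω` to be the drift integral itself, so that both sides are
  -- additive.
  have key := sub_le_sub_of_forall_short (F := fun t => α * ν.real (Ioc 0 t))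
    (G := fun t => (oscillationConst C α R + 1) * ∫ v in Ioc 0 t, γ v) zero_le_one hη ?_
  · simpa using key
  intro s t hs hst ht hlt
  rcases hst.eq_or_lt with rfl | hst'
  · simp
  obtain ⟨h0, h1, h2⟩ := hsmall s t hs hst' ht hlt
  rw [← mul_sub, ← mul_sub, measureReal_Ioc_sub hs hst, setIntegral_Ioc_sub
    (hγ.mono_set fun v hv => ⟨hv.1.le, hv.2.trans ht⟩) hs hst]
  exact (h.oscillation_le hC hO hα hR htr hγ hγ0 hg hs hst ht h0 le_rfl h1 h2).2

/-! ### From reflected equations to pushed paths -/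

/-- A solution of the reflection problem with absolutely continuous input is a pushed path. -/
theorem IsReflected.exists_isPushedPath {w z k g : ℝ → E d} (hO : IsOpen O)
    (h : IsReflected O w z k) (hg : IntegrableOn g (Icc 0 1))
    (hw : ∀ s t, 0 ≤ s → s ≤ t → t ≤ 1 → w t - w s = ∫ v in Ioc s t, g v) :
    ∃ (ξ : ℝ → E d) (ν : Measure ℝ), IsFiniteMeasure ν ∧ IsPushedPath O z g ξ ν := by
  obtain ⟨ξ, hξm, hξn, hξ⟩ := h.direction
  have : IsLocallyFiniteMeasure (dVar h.boundedVariation) := by unfold dVar; infer_instance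
  have hfin : IsFiniteMeasure ((dVar h.boundedVariation).restrict (Icc 0 1)) :=
    ⟨by rw [Measure.restrict_apply_univ]; exact isCompact_Icc.measure_lt_top⟩
  have hξI : IntegrableOn ξ (Icc 0 1) (dVar h.boundedVariation) :=
    Integrable.of_bound hξm 1 (hξn.mono fun _ hs => hs.1.le)
  refine ⟨ξ, _, hfin, h.continuousOn_path, h.mem_closure, hg, hξm, ?_, ?_⟩
  · filter_upwards [hξn, ae_restrict_mem measurableSet_Icc] with s hs hs'
    exact ⟨hs', mem_frontier_of_mem_unitNormals hO (h.mem_closure s hs') hs, hs⟩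
  · intro s t hs hst ht
    have hs' : s ∈ Icc (0 : ℝ) 1 := ⟨hs, hst.trans ht⟩
    have ht' : t ∈ Icc (0 : ℝ) 1 := ⟨hs.trans hst, ht⟩
    have hsub : Ioc s t ⊆ Icc 0 1 := fun v hv => ⟨hs.trans hv.1.le, hv.2.trans ht⟩
    rw [Measure.restrict_restrict measurableSet_Ioc, inter_eq_left.2 hsub, ← hw s t hs hst ht,
      h.equation t ht', h.equation s hs']
    have hk : k t - k s = ∫ v in Ioc s t, ξ v ∂(dVar h.boundedVariation) := by
      rw [hξ t ht', hξ s hs', ← Icc_union_Ioc_eq_Icc hs hst,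
        setIntegral_union (disjoint_left.2 fun v hv hv' => hv'.1.not_ge hv.2) measurableSet_Ioc
          (hξI.mono_set (Icc_subset_Icc_right hs'.2)) (hξI.mono_set hsub), add_sub_cancel_left]
    rw [← hk]; abel

/-! ### The coefficients -/

theorem intervalIntegral_sub_eq {f : ℝ → E d} (hf : IntegrableOn f (Icc 0 1)) {s t : ℝ}
    (hs : 0 ≤ s) (hst : s ≤ t) (ht : t ≤ 1) :
    (∫ v in (0 : ℝ)..t, f v) - ∫ v in (0 : ℝ)..s, f v = ∫ v in Ioc s t, f v := by
  rw [intervalIntegral.integral_of_le (hs.trans hst), intervalIntegral.integral_of_le hs]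
  exact setIntegral_Ioc_sub (hf.mono_set fun v hv => ⟨hv.1.le, hv.2.trans ht⟩) hs hst

/-- A solution of a reflected equation whose coefficients are evaluated along `y` is a pushed
path. -/
theorem exists_isPushedPath_of_coefficients {b : E d → E d} {σ : E d → E d →L[ℝ] E d} {M : ℝ}
    (hb : Continuous b) (hσ : Continuous σ) (hbM : ∀ x, ‖b x‖ ≤ M) (hσM : ∀ x, ‖σ x‖ ≤ M)
    {ψ : ℝ → E d} (hψ : IntegrableOn ψ (Icc 0 1)) {y : ℝ → E d}
    (hy : AEStronglyMeasurable y (volume.restrict (Icc 0 1))) (hO : IsOpen O) {x : E d}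
    {z k : ℝ → E d}
    (h : IsReflected O (fun t => x + (∫ s in (0 : ℝ)..t, b (y s)) +
      ∫ s in (0 : ℝ)..t, σ (y s) (ψ s)) z k) :
    ∃ (ξ : ℝ → E d) (ν : Measure ℝ), IsFiniteMeasure ν ∧
      IsPushedPath O z (fun s => b (y s) + σ (y s) (ψ s)) ξ ν := by
  have hbI : IntegrableOn (fun s => b (y s)) (Icc 0 1) :=
    Integrable.of_bound (hb.comp_aestronglyMeasurable hy) M (Eventually.of_forall fun s => hbM _)
  have hσI : IntegrableOn (fun s => σ (y s) (ψ s)) (Icc 0 1) := by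
    refine Integrable.mono' (hψ.norm.const_mul M) ?_ (Eventually.of_forall fun s => ?_)
    · exact isBoundedBilinearMap_apply.continuous.comp_aestronglyMeasurable
        ((hσ.comp_aestronglyMeasurable hy).prodMk hψ.aestronglyMeasurable)
    · exact ((σ (y s)).le_opNorm _).trans (mul_le_mul_of_nonneg_right (hσM _) (norm_nonneg _))
  refine h.exists_isPushedPath hO (hbI.add hσI) fun s t hs hst ht => ?_
  have hsub : Ioc s t ⊆ Icc 0 1 := fun v hv => ⟨hs.trans hv.1.le, hv.2.trans ht⟩
  rw [integral_add (hbI.mono_set hsub) (hσI.mono_set hsub),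
    ← intervalIntegral_sub_eq hbI hs hst ht, ← intervalIntegral_sub_eq hσI hs hst ht]
  abel

/-- Serves both for the size of the drift and for the difference of two drifts, where `M` becomes a
multiple of a distance. -/
theorem norm_add_apply_le {M : ℝ} {β v : E d} {A : E d →L[ℝ] E d} (hβ : ‖β‖ ≤ M)
    (hA : ‖A‖ ≤ M) : ‖β + A v‖ ≤ M * (1 + ‖v‖) := by
  have h1 := norm_add_le β (A v)
  have h2 := (A.le_opNorm v).trans (mul_le_mul_of_nonneg_right hA (norm_nonneg v))
  linarith

/-- Cauchy–Schwarz in the form of Young's inequality with weight `l = √(t - s)`; the integral is at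
most `l² + l/2 + r l`, and `l ≤ 1`. -/
theorem setIntegral_one_add_norm_le {ψ : ℝ → E d} {r : ℝ} (hψ : IntegrableOn ψ (Icc 0 1))
    (hψ2 : IntegrableOn (fun s => ‖ψ s‖ ^ 2) (Icc 0 1))
    (hr : (∫ s in Ioc 0 1, ‖ψ s‖ ^ 2) ≤ 2 * r) {s t : ℝ} (hs : 0 ≤ s) (hst : s ≤ t)
    (ht : t ≤ 1) : (∫ v in Ioc s t, (1 + ‖ψ v‖)) ≤ (3 / 2 + r) * √(t - s) := by
  rcases hst.eq_or_lt with rfl | hlt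
  · simp
  have hsub : Ioc s t ⊆ Icc 0 1 := fun v hv => ⟨hs.trans hv.1.le, hv.2.trans ht⟩
  set l := √(t - s) with hl
  have hl0 : 0 < l := Real.sqrt_pos.2 (sub_pos.2 hlt)
  have hl1 : l ≤ 1 := Real.sqrt_le_one.2 (by linarith)
  have hl2 : l ^ 2 = t - s := Real.sq_sqrt (sub_nonneg.2 hst)
  have hle : (∫ v in Ioc s t, ‖ψ v‖ ^ 2) ≤ 2 * r :=
    (setIntegral_mono_set (hψ2.mono_set Ioc_subset_Icc_self)
      (Eventually.of_forall fun v => sq_nonneg _)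
      (Ioc_subset_Ioc hs ht).eventuallyLE).trans hr
  have hc : ∀ c : ℝ, IntegrableOn (fun _ : ℝ => c) (Ioc s t) := fun c =>
    integrableOn_const (by simp)
  have key : (∫ v in Ioc s t, (1 + ‖ψ v‖)) ≤
      ∫ v in Ioc s t, ((1 + 1 / (2 * l)) + l / 2 * ‖ψ v‖ ^ 2) := by
    refine setIntegral_mono ((hc 1).add (hψ.mono_set hsub).norm)
      ((hc _).add ((hψ2.mono_set hsub).const_mul _)) fun v => ?_
    have h1 : 1 / (2 * l) + l / 2 * ‖ψ v‖ ^ 2 - ‖ψ v‖ = (l * ‖ψ v‖ - 1) ^ 2 / (2 * l) := by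
      field_simp; ring
    have h2 : 0 ≤ (l * ‖ψ v‖ - 1) ^ 2 / (2 * l) := by positivity
    show 1 + ‖ψ v‖ ≤ 1 + 1 / (2 * l) + l / 2 * ‖ψ v‖ ^ 2
    linarith
  refine key.trans ?_
  rw [integral_add (hc _) ((hψ2.mono_set hsub).const_mul _), integral_const_mul,
    setIntegral_const, Real.volume_real_Ioc_of_le hst, smul_eq_mul, ← hl2]
  have h1 : l ^ 2 * (1 + 1 / (2 * l)) = l ^ 2 + l / 2 := by field_simp
  rw [h1]
  have h2 : l / 2 * (∫ v in Ioc s t, ‖ψ v‖ ^ 2) ≤ l / 2 * (2 * r) :=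
    mul_le_mul_of_nonneg_left hle (by positivity)
  nlinarith

/-! ### The dyadic step function -/

/-- No regularity of `f` is needed, since the composition factors through `ℕ`. -/
theorem measurable_comp_dyadicStep (n : ℕ) (f : ℝ → E d) :
    Measurable fun t => f (dyadicStep n t) := by
  have h : Measurable fun t : ℝ => ⌊2 ^ n * t⌋₊ :=
    Nat.measurable_floor.comp (measurable_const_mul _)
  exact (measurable_from_nat (f := fun j : ℕ =>
    f ((min j (2 ^ n - 1) : ℕ) / 2 ^ n : ℝ))).comp h

theorem dyadicStep_nonneg (n : ℕ) (t : ℝ) : 0 ≤ dyadicStep n t := by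
  unfold dyadicStep; positivity

theorem dyadicStep_le {n : ℕ} {t : ℝ} (ht : 0 ≤ t) : dyadicStep n t ≤ t := by
  unfold dyadicStep
  rw [div_le_iff₀ (by positivity), mul_comm]
  exact (Nat.cast_le.2 (min_le_left _ _)).trans (Nat.floor_le (by positivity))

theorem sub_dyadicStep_le {n : ℕ} {t : ℝ} (ht : t ≤ 1) : t - dyadicStep n t ≤ (1 / 2) ^ n := by
  unfold dyadicStep
  have h2 : (0 : ℝ) < 2 ^ n := by positivity
  rw [div_pow, one_pow, sub_le_iff_le_add, ← add_div, le_div_iff₀ h2, mul_comm]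
  -- The second case is the closed right end: it occurs only for `t = 1`.
  rcases min_cases ⌊2 ^ n * t⌋₊ (2 ^ n - 1) with ⟨h, -⟩ | ⟨h, -⟩
  · rw [h]; linarith [Nat.lt_floor_add_one (2 ^ n * t)]
  · rw [h, Nat.cast_sub Nat.one_le_two_pow]
    push_cast
    nlinarith

/-! ### The action -/

theorem of_action_le {ψ : ℝ → E d} {r : ℝ} (hr : 0 < r) (h : action ψ ≤ ENNReal.ofReal r) :
    IntegrableOn ψ (Icc 0 1) ∧ IntegrableOn (fun s => ‖ψ s‖ ^ 2) (Icc 0 1) ∧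
      (∫ s in Ioc 0 1, ‖ψ s‖ ^ 2) ≤ 2 * r := by
  unfold action at h
  split_ifs at h with hψ
  · refine ⟨hψ.integrable one_le_two, hψ.integrable_norm_pow two_ne_zero, ?_⟩
    rw [ENNReal.ofReal_le_ofReal_iff hr.le, intervalIntegral.integral_of_le zero_le_one] at h
    linarith
  · simp at h

/-! ### Energy bounds and the Euler error -/

/-- The drift, the oscillation and the push of a path whose drift is at most `M (1 + |ψ|)`, in
terms of the energy of `ψ`. -/
theorem IsPushedPath.bounds_of_energy {z g ξ : ℝ → E d} {ν : Measure ℝ} [IsFiniteMeasure ν]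
    {C α R : ℝ} (hC : 0 ≤ C)
    (hO : ∀ x ∈ frontier O, ∀ x' ∈ closure O, ∀ k ∈ unitNormals O x,
      0 ≤ inner ℝ (x - x') k + C * ‖x - x'‖ ^ 2)
    (hα : 0 < α) (hR : 0 < R)
    (htr : ∀ x ∈ frontier O, ∃ c : E d, ‖c‖ = 1 ∧
      ∀ x' ∈ frontier O, ‖x' - x‖ ≤ R → ∀ m ∈ unitNormals O x', α ≤ inner ℝ m c)
    (h : IsPushedPath O z g ξ ν) {M r : ℝ} (hM : 0 < M) (hr : 0 < r) {ψ : ℝ → E d}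
    (hψ : IntegrableOn ψ (Icc 0 1)) (hψ2 : IntegrableOn (fun s => ‖ψ s‖ ^ 2) (Icc 0 1))
    (hψr : (∫ s in Ioc 0 1, ‖ψ s‖ ^ 2) ≤ 2 * r) (hg : ∀ v, ‖g v‖ ≤ M * (1 + ‖ψ v‖))
    {η : ℝ} (hη : 0 < η) (hη1 : M * (3 / 2 + r) * √η ≤ 1)
    (hηR : oscillationConst C α R * (M * (3 / 2 + r) * √η) ≤ R / 4) :
    ν.real (Ioc 0 1) ≤ (oscillationConst C α R + 1) * (M * (3 / 2 + r)) / α ∧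
      ∀ s t, 0 ≤ s → s ≤ t → t ≤ 1 → t - s ≤ η →
        ‖z t - z s‖ ≤ oscillationConst C α R * (M * (3 / 2 + r) * √η) := by
  set κ := oscillationConst C α R with hκ
  have hκ0 : 0 < κ := Real.exp_pos _
  have hγ : IntegrableOn (fun v => M * (1 + ‖ψ v‖)) (Icc 0 1) :=
    ((integrableOn_const (by simp)).add hψ.norm).const_mul M
  have hγ0 : ∀ v, 0 ≤ M * (1 + ‖ψ v‖) := fun v => by positivity
  have hint : ∀ s t, 0 ≤ s → s ≤ t → t ≤ 1 →
      (∫ v in Ioc s t, M * (1 + ‖ψ v‖)) ≤ M * (3 / 2 + r) * √(t - s) := by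
    intro s t hs hst ht
    rw [integral_const_mul, mul_assoc]
    exact mul_le_mul_of_nonneg_left (setIntegral_one_add_norm_le hψ hψ2 hψr hs hst ht) hM.le
  have hshort : ∀ s t, 0 ≤ s → s ≤ t → t ≤ 1 → t - s ≤ η →
      (∫ v in Ioc s t, M * (1 + ‖ψ v‖)) ≤ M * (3 / 2 + r) * √η := fun s t hs hst ht hlt =>
    (hint s t hs hst ht).trans
      (mul_le_mul_of_nonneg_left (Real.sqrt_le_sqrt hlt) (by positivity))
  refine ⟨?_, fun s t hs hst ht hlt => ?_⟩
  · rw [le_div_iff₀ hα, mul_comm]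
    refine (h.mul_measureReal_univ_le hC hO hα hR htr hγ hγ0 (fun v _ => hg v) hη
      fun s t hs hst ht hlt => ⟨?_, ?_, ?_⟩).trans
      (mul_le_mul_of_nonneg_left ?_ (by positivity))
    -- Strict positivity of the drift bound, needed to divide by it, comes from the summand 1 in `M
    -- (1 + |ψ|)`.
    · have hsub : Ioc s t ⊆ Icc 0 1 := fun v hv => ⟨hs.trans hv.1.le, hv.2.trans ht⟩
      have h1 : (∫ _ in Ioc s t, M) ≤ ∫ v in Ioc s t, M * (1 + ‖ψ v‖) :=
        setIntegral_mono (integrableOn_const (by simp)) (hγ.mono_set hsub) fun v => by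
          show M ≤ M * (1 + ‖ψ v‖)
          nlinarith [norm_nonneg (ψ v)]
      rw [setIntegral_const, Real.volume_real_Ioc_of_le hst.le, smul_eq_mul] at h1
      exact (mul_pos (sub_pos.2 hst) hM).trans_le h1
    · exact (hshort s t hs hst.le ht hlt.le).trans hη1
    · exact (mul_le_mul_of_nonneg_left (hshort s t hs hst.le ht hlt.le) hκ0.le).trans hηR
    · simpa using hint 0 1 le_rfl zero_le_one le_rfl
  · exact (h.oscillation_le hC hO hα hR htr hγ hγ0 (fun v _ => hg v) hs hst ht
      (by have := Real.sqrt_pos.2 hη; positivity) (hshort s t hs hst ht hlt) hη1 hηR).1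

theorem tendsto_sqrt_half_pow : Tendsto (fun n : ℕ => √((1 / 2 : ℝ) ^ n)) atTop (𝓝 0) := by
  have h := (Real.continuous_sqrt.tendsto 0).comp
    (tendsto_pow_atTop_nhds_zero_of_lt_one (r := (1 / 2 : ℝ)) (by norm_num) (by norm_num))
  rwa [Real.sqrt_zero] at h

/-- The Euler approximations converge at the rate `2^(-n/2)`, uniformly on the sublevel sets of
the action. -/
theorem exists_euler_error_le (hO : IsOpen O) (hcond : DomainConditions O)
    {b : E d → E d} {σ : E d → E d →L[ℝ] E d}
    (hb_bdd : ∃ M : ℝ, ∀ x, ‖b x‖ ≤ M) (hb_lip : ∃ K : ℝ≥0, LipschitzWith K b)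
    (hσ_bdd : ∃ M : ℝ, ∀ x, ‖σ x‖ ≤ M) (hσ_lip : ∃ K : ℝ≥0, LipschitzWith K σ)
    {r : ℝ} (hr : 0 < r) :
    ∃ Q : ℝ, ∀ᶠ n : ℕ in atTop, ∀ ψ : ℝ → E d, action ψ ≤ ENNReal.ofReal r →
      ∀ x z k zₙ kₙ, IsSkeletonSolution O b σ ψ x z k → IsEulerSolution O b σ n ψ x zₙ kₙ →
        ∀ t ∈ Icc (0 : ℝ) 1, ‖zₙ t - z t‖ ≤ Q * √((1 / 2) ^ n) := by
  obtain ⟨C, hC, hnor⟩ := hcond.uniform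
  obtain ⟨α, hα, R, hR, htr⟩ := hcond.exists_transversal
  obtain ⟨Mb, hMb⟩ := hb_bdd
  obtain ⟨Mσ, hMσ⟩ := hσ_bdd
  obtain ⟨Lb, hLb⟩ := hb_lip
  obtain ⟨Lσ, hLσ⟩ := hσ_lip
  set M : ℝ := max 1 (max Mb Mσ) with hM
  have hM0 : 0 < M := lt_max_of_lt_left one_pos
  have hbM : ∀ x, ‖b x‖ ≤ M := fun x =>
    (hMb x).trans ((le_max_left _ _).trans (le_max_right _ _))
  have hσM : ∀ x, ‖σ x‖ ≤ M := fun x =>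
    (hMσ x).trans ((le_max_right _ _).trans (le_max_right _ _))
  set L : ℝ := max Lb Lσ with hL
  have hL0 : 0 ≤ L := le_max_of_le_left Lb.coe_nonneg
  set κ := oscillationConst C α R with hκ
  have hκ0 : 0 < κ := Real.exp_pos _
  set S : ℝ := 3 / 2 + r with hS
  have hS0 : 0 < S := by positivity
  -- `W` bounds the total push of either path, and `Z` is the resulting Gronwall factor times the
  -- bound `L S` on `∫ p`.
  set W : ℝ := (κ + 1) * (M * S) / α with hW
  set Z : ℝ := Real.exp (3 * (L * S) + 2 * C * (W + W)) * (L * S) with hZ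
  have hZ0 : 0 ≤ Z := by positivity
  have hlim := tendsto_sqrt_half_pow
  have hlim1 : ∀ᶠ n : ℕ in atTop, M * S * √((1 / 2 : ℝ) ^ n) < 1 :=
    (hlim.const_mul (M * S)).eventually_lt_const (by simp)
  have hlim2 : ∀ᶠ n : ℕ in atTop, κ * (M * S * √((1 / 2 : ℝ) ^ n)) < R / 4 :=
    ((hlim.const_mul (M * S)).const_mul κ).eventually_lt_const (by simp; positivity)
  refine ⟨√Z * (κ * (M * S)), ?_⟩
  filter_upwards [hlim1, hlim2] with n hn1 hn2 ψ hψ x z k zₙ kₙ hz hzₙ t ht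
  obtain ⟨hψI, hψ2, hψr⟩ := of_action_le hr hψ
  have hη : (0 : ℝ) < (1 / 2) ^ n := by positivity
  obtain ⟨ξ, ν, hν, hp⟩ := exists_isPushedPath_of_coefficients hLb.continuous hLσ.continuous hbM hσM
    hψI (hz.continuousOn_path.aestronglyMeasurable measurableSet_Icc) hO hz
  obtain ⟨ξₙ, νₙ, hνₙ, hpₙ⟩ := exists_isPushedPath_of_coefficients hLb.continuous hLσ.continuous
    hbM hσM hψI (measurable_comp_dyadicStep n zₙ).aestronglyMeasurable hO hzₙ
  have hV := (hp.bounds_of_energy hC hnor hα hR htr hM0 hr hψI hψ2 hψr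
    (fun v => norm_add_apply_le (hbM _) (hσM _)) hη hn1.le hn2.le).1
  obtain ⟨hVₙ, hosc⟩ := hpₙ.bounds_of_energy hC hnor hα hR htr hM0 hr hψI hψ2 hψr
    (fun v => norm_add_apply_le (hbM _) (hσM _)) hη hn1.le hn2.le
  set δ : ℝ := κ * (M * S * √((1 / 2) ^ n)) with hδ
  have hδ0 : 0 ≤ δ := by positivity
  have hpI : IntegrableOn (fun v => L * (1 + ‖ψ v‖)) (Icc 0 1) :=
    ((integrableOn_const (by simp)).add hψI.norm).const_mul L
  have key := hpₙ.norm_sub_sq_le hC hnor hp (p := fun v => L * (1 + ‖ψ v‖)) (δ := δ) le_rfl ht.1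
    ht.2 hδ0 hpI (fun v => by positivity) (fun v hv => by
      have hv1 : v ≤ 1 := hv.2.trans ht.2
      -- Freezing the argument shifts it by at most the oscillation `δ` of `zₙ` over one dyadic
      -- step.
      have h1 : ‖zₙ (dyadicStep n v) - z v‖ ≤ ‖zₙ v - z v‖ + δ := by
        have h2 := hosc _ _ (dyadicStep_nonneg n v) (dyadicStep_le hv.1) hv1 (sub_dyadicStep_le hv1)
        have h3 := norm_sub_le (zₙ v - z v) (zₙ v - zₙ (dyadicStep n v))
        rw [sub_sub_sub_cancel_left] at h3
        linarith
      have h2 : ‖b (zₙ (dyadicStep n v)) - b (z v)‖ ≤ L * (‖zₙ v - z v‖ + δ) :=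
        (hLb.norm_sub_le _ _).trans
          (mul_le_mul (le_max_left _ _) h1 (norm_nonneg _) hL0)
      have h3 : ‖σ (zₙ (dyadicStep n v)) - σ (z v)‖ ≤ L * (‖zₙ v - z v‖ + δ) :=
        (hLσ.norm_sub_le _ _).trans
          (mul_le_mul (le_max_right _ _) h1 (norm_nonneg _) hL0)
      have h4 := norm_add_apply_le (v := ψ v) h2 h3
      rw [sub_apply] at h4
      rw [add_sub_add_comm]
      exact h4.trans_eq (by ring))
  have h0 : ‖zₙ 0 - z 0‖ = 0 := by
    have h1 := hz.equation 0 (by simp)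
    have h2 := hzₙ.equation 0 (by simp)
    rw [h1, h2, hz.push_zero, hzₙ.push_zero]
    simp
  rw [h0] at key
  have hP : (∫ v in Ioc 0 t, L * (1 + ‖ψ v‖)) ≤ L * S := by
    rw [integral_const_mul]
    refine mul_le_mul_of_nonneg_left ?_ hL0
    refine (setIntegral_one_add_norm_le hψI hψ2 hψr le_rfl ht.1 ht.2).trans ?_
    exact mul_le_of_le_one_right hS0.le (Real.sqrt_le_one.2 (by linarith [ht.2]))
  have hP0 : 0 ≤ ∫ v in Ioc 0 t, L * (1 + ‖ψ v‖) :=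
    setIntegral_nonneg measurableSet_Ioc fun v _ => by positivity
  have hVt : ν.real (Ioc 0 t) ≤ W := (measureReal_mono (Ioc_subset_Ioc_right ht.2)).trans hV
  have hVtₙ : νₙ.real (Ioc 0 t) ≤ W := (measureReal_mono (Ioc_subset_Ioc_right ht.2)).trans hVₙ
  have hsq : ‖zₙ t - z t‖ ^ 2 ≤ (√Z * δ) ^ 2 := by
    rw [mul_pow, Real.sq_sqrt hZ0, hZ, mul_assoc, mul_comm (L * S)]
    refine key.trans (mul_le_mul (Real.exp_le_exp.2 ?_) ?_ ?_ (Real.exp_pos _).le)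
    · have h1 := mul_le_mul_of_nonneg_left (add_le_add hVtₙ hVt) (show 0 ≤ 2 * C by positivity)
      linarith
    · have h1 := mul_le_mul_of_nonneg_left hP (sq_nonneg δ)
      linarith
    · have h1 := mul_nonneg (sq_nonneg δ) hP0
      linarith
  have := (pow_le_pow_iff_left₀ (norm_nonneg _) (by positivity) two_ne_zero).1 hsq
  exact this.trans_eq (by rw [hδ]; ring)

end Reflected

theorem theorem2p2 {d : ℕ} (O : Set (Reflected.E d)) (hO : IsOpen O)
    (hOb : Bornology.IsBounded O) (hcond : Reflected.DomainConditions O)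
    (b : Reflected.E d → Reflected.E d)
    (σ : Reflected.E d → Reflected.E d →L[ℝ] Reflected.E d)
    (hb_bdd : ∃ M : ℝ, ∀ x, ‖b x‖ ≤ M) (hb_lip : ∃ K : ℝ≥0, LipschitzWith K b)
    (hσ_bdd : ∃ M : ℝ, ∀ x, ‖σ x‖ ≤ M) (hσ_lip : ∃ K : ℝ≥0, LipschitzWith K σ)
    (r : ℝ) (hr : 0 < r) :
    Tendsto
      (fun n : ℕ =>
        ⨆ (ψ : ℝ → Reflected.E d) (_ : Reflected.action ψ ≤ ENNReal.ofReal r)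
          (x : Reflected.E d) (_ : x ∈ closure O)
          (z : ℝ → Reflected.E d) (k : ℝ → Reflected.E d)
          (_ : Reflected.IsSkeletonSolution O b σ ψ x z k)
          (zₙ : ℝ → Reflected.E d) (kₙ : ℝ → Reflected.E d)
          (_ : Reflected.IsEulerSolution O b σ n ψ x zₙ kₙ)
          (t : ℝ) (_ : t ∈ Icc (0 : ℝ) 1), ‖zₙ t - z t‖ₑ)
      atTop (𝓝 0) := by
  obtain ⟨Q, hQ⟩ :=
    Reflected.exists_euler_error_le hO hcond hb_bdd hb_lip hσ_bdd hσ_lip hr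
  have hlim : Tendsto (fun n : ℕ => ENNReal.ofReal (Q * √((1 / 2 : ℝ) ^ n))) atTop (𝓝 0) := by
    have h := ENNReal.tendsto_ofReal (Reflected.tendsto_sqrt_half_pow.const_mul Q)
    rwa [mul_zero, ENNReal.ofReal_zero] at h
  -- The error bound holds only for large `n`, hence the eventual form of the squeeze.
  refine tendsto_of_tendsto_of_tendsto_of_le_of_le' tendsto_const_nhds hlim
    (Eventually.of_forall fun n => zero_le) ?_
  filter_upwards [hQ] with n hn
  refine iSup₂_le fun ψ hψ => iSup₂_le fun x _ => iSup₂_le fun z k => iSup_le fun hz =>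
    iSup₂_le fun zₙ kₙ => iSup_le fun hzₙ => iSup₂_le fun t ht => ?_
  rw [← ofReal_norm]
  exact ENNReal.ofReal_le_ofReal (hn ψ hψ x z k zₙ kₙ hz hzₙ t ht)
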